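/- For $f\in L^2(\mathbb R^n)$ whose Fourier transform $\widehat f$ (the unitary $L^2$ extension of $\widehat f(\xi)=\int f(x)e^{-2\pi i x\cdot\xi}\,dx$) vanishes a.e. outside a bounded set, put $$e^{it\Delta}f(x)=\int_{\mathbb R^n}\widehat f(\xi)\,e^{2\pi i x\cdot\xi-4\pi^2 it|\xi|^2}\,d\xi .$$ Let $n\ge 2$. There are constants $0<c<C$ depending only on $n$ such that for every real $s<\frac{n}{2(n+2)}$ there exist positive reals $R_k\to\infty$ and nonzero $f_k\in L^2(\mathbb R^n)$ with $\widehat{f_k}$ supported in the annulus $\{cR_k\le|\xi|\le CR_k\}$ such that, for every $T>0$, $$\lim_{k\to\infty}\frac{\bigl\|\sup_{0<t\le T}|e^{it\Delta}f_k(x)|\bigr\|_{L^2(B(0,1))}}{R_k^{s}\,\|f_k\|_{L^2(\mathbb R^n)}}=\infty .$$ -/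

import Mathlib

open MeasureTheory Filter Topology
open scoped FourierTransform ENNReal

noncomputable section

/-- The Hilbert space `L²(ℝⁿ)` of complex-valued functions. -/
abbrev L2 (n : ℕ) : Type := Lp ℂ 2 (volume : Measure (EuclideanSpace ℝ (Fin n)))

/-- The Fourier transform of `f` is supported in the set `A`, where the Fourier transform is the
unitary one on `L²(ℝⁿ)`, extending `f ↦ ∫ f(x) e^{-2πi x·ξ} dx`. -/
def FourierSupportedIn {n : ℕ} (f : L2 n) (A : Set (EuclideanSpace ℝ (Fin n))) : Prop :=
  ∀ᵐ ξ ∂(volume : Measure (EuclideanSpace ℝ (Fin n))), ξ ∉ A → (𝓕 f : L2 n) ξ = 0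

/-- The closed annulus `a ≤ |ξ| ≤ b`. -/
def annulus (n : ℕ) (a b : ℝ) : Set (EuclideanSpace ℝ (Fin n)) :=
  {ξ | a ≤ ‖ξ‖ ∧ ‖ξ‖ ≤ b}

/-- The solution of `i ∂ₜ u + Δ u = 0` with initial data `f`:
`e^{itΔ} f (x) = ∫ 𝓕f(ξ) e^{2πi x·ξ - 4π² i t |ξ|²} dξ`.
If `𝓕f` vanishes outside a bounded set then `𝓕f` is integrable, so the integral converges
absolutely for every `x` and every `t`. -/
def schrodinger {n : ℕ} (f : L2 n) (t : ℝ) (x : EuclideanSpace ℝ (Fin n)) : ℂ :=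
  ∫ ξ : EuclideanSpace ℝ (Fin n), (𝓕 f : L2 n) ξ *
    Complex.exp (Complex.I *
      ((2 * Real.pi * inner ℝ x ξ - 4 * Real.pi ^ 2 * t * ‖ξ‖ ^ 2 : ℝ) : ℂ))

/-- The maximal function `sup_{0 < t ≤ T} |e^{itΔ} f (x)|`, with values in `[0, ∞]`. -/
def schrodingerMax {n : ℕ} (T : ℝ) (f : L2 n) (x : EuclideanSpace ℝ (Fin n)) : ℝ≥0∞ :=
  ⨆ t ∈ Set.Ioc (0 : ℝ) T, ‖schrodinger f t x‖ₑ

end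

/-! Let `𝓕 f` be the indicator of a set A made of M^n balls of fixed radius ε, centred on a shifted
lattice of spacing L. At time t = j/(2πL²) the phase (in units of 2π) at the centre indexed by m is,
modulo integers and a term independent of m, Σ mᵢ(L xᵢ - j/Q^(i+1)) (`phase_latticeFreq`). For each
x, choosing the base-Q digits of j puts every bracket within 1/Q of an integer
(`exists_nat_lt_pow_forall_abs_sub_le`). With Q = 20nM the packets then add without cancellation, so
the maximal function is at least |A|/2 on the whole unit ball, while ‖f‖ = |A|^(1/2). The quotient
of norms is thus ≳ |A|^(1/2) ≳ M^(n/2).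

The phase must also be nearly constant on each ball. This needs Q^n M ≲ L, whence L = M^(n+1), R =
LM = M^(n+2) and M^(n/2) = R^(n/(2(n+2))). -/

/-! ### Simultaneous approximation by base-Q digits -/

/-- Modulo 1, j/Q^(i+1) depends only on the lowest i+1 digits of j, with digit i leading. The digits
can therefore be chosen one at a time, each fixing one coordinate to precision 1/Q. -/
theorem exists_nat_lt_pow_forall_abs_sub_le {Q : ℕ} (hQ : 0 < Q) (y : ℕ → ℝ) (n : ℕ) :
    ∃ j < Q ^ n, ∀ i < n, ∃ z : ℤ, |y i - j / (Q : ℝ) ^ (i + 1) - z| ≤ 1 / Q := by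
  have hQ' : (0 : ℝ) < Q := by exact_mod_cast hQ
  induction n with
  | zero => exact ⟨0, by simp, by simp⟩
  | succ n ih =>
    obtain ⟨j, hj, h⟩ := ih
    set D : ℤ := ⌊Q * (y n - j / (Q : ℝ) ^ (n + 1))⌋ with hD
    have hQz : (0 : ℤ) < Q := by exact_mod_cast hQ
    obtain ⟨d, hd⟩ := Int.eq_ofNat_of_zero_le (Int.emod_nonneg D hQz.ne')
    have hdQ : d < Q := by
      have := Int.emod_lt_of_pos D hQz
      omega
    have hDd : (D : ℝ) = d + Q * ((D / Q : ℤ) : ℝ) := by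
      have := Int.emod_add_mul_ediv D Q
      rw [hd] at this
      exact_mod_cast this.symm
    -- The new digit d shifts the earlier quotients by integers and the new one by d/Q.
    refine ⟨j + d * Q ^ n, ?_, fun i hi => ?_⟩
    · calc j + d * Q ^ n < Q ^ n + d * Q ^ n := by omega
        _ = (d + 1) * Q ^ n := by ring
        _ ≤ Q * Q ^ n := Nat.mul_le_mul_right _ hdQ
        _ = Q ^ (n + 1) := by ring
    · rcases Nat.lt_succ_iff_lt_or_eq.mp hi with hi | rfl
      · obtain ⟨z, hz⟩ := h i hi
        obtain ⟨r, rfl⟩ := Nat.exists_eq_add_of_lt hi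
        refine ⟨z - d * Q ^ r, ?_⟩
        convert! hz using 2
        push_cast
        field_simp
        ring
      · refine ⟨D / Q, ?_⟩
        have h1 := Int.floor_le (Q * (y i - j / (Q : ℝ) ^ (i + 1)))
        have h2 := Int.lt_floor_add_one (Q * (y i - j / (Q : ℝ) ^ (i + 1)))
        rw [← hD] at h1 h2
        have key : y i - ((j + d * Q ^ i : ℕ) : ℝ) / (Q : ℝ) ^ (i + 1) - ((D / Q : ℤ) : ℝ)
            = (Q * (y i - j / (Q : ℝ) ^ (i + 1)) - D) / Q := by
          rw [hDd]
          push_cast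
          field_simp
          ring
        rw [key, abs_div, abs_of_pos hQ']
        gcongr
        rw [abs_le]
        constructor <;> linarith

/-! ### Integrals without cancellation -/

theorem half_le_cos_of_abs_sub_int_le {y : ℝ} {N : ℤ} (h : |y - N| ≤ 1 / 10) :
    1 / 2 ≤ Real.cos (2 * Real.pi * y) := by
  have hpi := Real.pi_pos
  rw [← Real.cos_sub_int_mul_two_pi _ N, ← Real.cos_abs, ← Real.cos_pi_div_three]
  have e : |2 * Real.pi * y - N * (2 * Real.pi)| = 2 * Real.pi * |y - N| := by
    rw [← abs_of_pos (show 0 < 2 * Real.pi by positivity), ← abs_mul]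
    rw [abs_of_pos (show 0 < 2 * Real.pi by positivity)]
    ring_nf
  rw [e]
  apply Real.cos_le_cos_of_nonneg_of_le_pi (by positivity) (by linarith)
  nlinarith

/-- After rotation by the common phase c, the integrand has real part at least 1/2 on A. -/
theorem half_measureReal_le_norm_setIntegral_exp {α : Type*} [MeasurableSpace α] {μ : Measure α}
    {A : Set α} (hA : MeasurableSet A) (hμ : μ A ≠ ∞) {g : α → ℝ} (hg : Measurable g) (c : ℝ)
    (h : ∀ ξ ∈ A, ∃ N : ℤ, |g ξ - c - N| ≤ 1 / 10) :
    μ.real A / 2 ≤ ‖∫ ξ in A, Complex.exp (Complex.I * ((2 * Real.pi * g ξ : ℝ) : ℂ)) ∂μ‖ := by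
  have : IsFiniteMeasure (μ.restrict A) := ⟨by simpa using hμ.lt_top⟩
  have hint : ∀ u : α → ℝ, Measurable u →
      Integrable (fun ξ => Complex.exp (Complex.I * (u ξ : ℂ))) (μ.restrict A) := by
    intro u hu
    refine Integrable.of_bound (C := 1) (by fun_prop) (Eventually.of_forall fun ξ => ?_)
    rw [mul_comm, Complex.norm_exp_ofReal_mul_I]
  have hre : ∀ v : ℝ, (Complex.exp (Complex.I * (v : ℂ))).re = Real.cos v := by
    intro v
    rw [mul_comm, Complex.exp_ofReal_mul_I_re]
  calc μ.real A / 2 = ∫ _ in A, (1 / 2 : ℝ) ∂μ := by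
        simp [div_eq_mul_inv]
    _ ≤ ∫ ξ in A, Real.cos (2 * Real.pi * (g ξ - c)) ∂μ := by
        refine setIntegral_mono_on (integrable_const _) ?_ hA fun ξ hξ => ?_
        · have := (hint (fun ξ => 2 * Real.pi * (g ξ - c)) (by fun_prop)).re
          simp only [RCLike.re_eq_complex_re, hre] at this
          exact this
        · obtain ⟨N, hN⟩ := h ξ hξ
          exact half_le_cos_of_abs_sub_int_le hN
    _ = (∫ ξ in A, Complex.exp (Complex.I * ((2 * Real.pi * (g ξ - c) : ℝ) : ℂ)) ∂μ).re := by
        rw [← RCLike.re_eq_complex_re, ← integral_re (hint _ (by fun_prop))]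
        simp only [RCLike.re_eq_complex_re, hre]
    _ ≤ ‖∫ ξ in A, Complex.exp (Complex.I * ((2 * Real.pi * (g ξ - c) : ℝ) : ℂ)) ∂μ‖ :=
        Complex.re_le_norm _
    _ = ‖Complex.exp (((-(2 * Real.pi * c) : ℝ) : ℂ) * Complex.I) *
          ∫ ξ in A, Complex.exp (Complex.I * ((2 * Real.pi * g ξ : ℝ) : ℂ)) ∂μ‖ := by
        rw [← integral_const_mul]
        congr 2
        ext ξ
        rw [← Complex.exp_add]
        congr 1
        push_cast
        ring
    _ = _ := by rw [norm_mul, Complex.norm_exp_ofReal_mul_I, one_mul]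

/-! ### The frequency set -/

/-- Centres of the frequency balls: a translate of the lattice points `L m`, `0 ≤ mᵢ < M`, the
translation being chosen so that the wave packets sweep out the unit ball. -/
noncomputable def latticeFreq {n : ℕ} (M Q : ℕ) (L : ℝ) (m : Fin n → Fin M) : EuclideanSpace ℝ (Fin n) :=
  WithLp.toLp 2 fun i => L * (M + (m i : ℕ) + ((Q : ℝ) ^ ((i : ℕ) + 1))⁻¹ / 2)

/-- The union of the balls of radius `ε` around the points `latticeFreq M Q L m`. -/
def freqSet (n M Q : ℕ) (L ε : ℝ) : Set (EuclideanSpace ℝ (Fin n)) :=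
  ⋃ m : Fin n → Fin M, Metric.ball (latticeFreq M Q L m) ε

theorem isOpen_freqSet (n M Q : ℕ) (L ε : ℝ) : IsOpen (freqSet n M Q L ε) :=
  isOpen_iUnion fun _ => Metric.isOpen_ball

theorem volume_freqSet_ne_top (n M Q : ℕ) (L ε : ℝ) : volume (freqSet n M Q L ε) ≠ ∞ := by
  refine ((measure_iUnion_le _).trans_lt ?_).ne
  rw [tsum_fintype]
  exact ENNReal.sum_lt_top.2 fun _ _ => measure_ball_lt_top

theorem le_dist_latticeFreq {n M Q : ℕ} {L : ℝ} (hL : 0 ≤ L) {m m' : Fin n → Fin M} (h : m ≠ m') :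
    L ≤ dist (latticeFreq M Q L m) (latticeFreq M Q L m') := by
  obtain ⟨i, hi⟩ := Function.ne_iff.1 h
  have h1 : (1 : ℝ) ≤ |((m i : ℕ) : ℝ) - ((m' i : ℕ) : ℝ)| := by
    have : ((m i : ℕ) : ℤ) - ((m' i : ℕ) : ℤ) ≠ 0 := by omega
    have := Int.one_le_abs this
    exact_mod_cast this
  calc L ≤ L * |((m i : ℕ) : ℝ) - ((m' i : ℕ) : ℝ)| := le_mul_of_one_le_right hL h1
    _ = ‖(latticeFreq M Q L m - latticeFreq M Q L m') i‖ := by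
        rw [Real.norm_eq_abs]
        nth_rw 1 [← abs_of_nonneg hL]
        rw [← abs_mul]
        congr 1
        simp only [latticeFreq, PiLp.sub_apply]
        ring
    _ ≤ _ := by
        rw [dist_eq_norm]
        exact PiLp.norm_apply_le _ i

theorem pow_mul_le_volume_freqSet {n M Q : ℕ} {L ε : ℝ} (hε : 0 < ε) (hL : 2 * ε ≤ L) :
    (M : ℝ) ^ n * volume.real (Metric.ball (0 : EuclideanSpace ℝ (Fin n)) ε) ≤
      volume.real (freqSet n M Q L ε) := by
  rw [freqSet, measureReal_def volume (⋃ _, _), measure_iUnion _ fun _ => measurableSet_ball]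
  · simp [Measure.addHaar_ball_center, measureReal_def]
  · intro m m' h
    exact Metric.ball_disjoint_ball (by linarith [le_dist_latticeFreq (Q := Q) (by linarith) h])

theorem latticeFreq_apply_le {n M Q : ℕ} (hQ : 0 < Q) {L : ℝ} (hL : 0 ≤ L) (m : Fin n → Fin M)
    (i : Fin n) : latticeFreq M Q L m i ≤ 2 * (L * M) := by
  have h1 : ((m i : ℕ) : ℝ) + 1 ≤ M := by exact_mod_cast (m i).2
  have h2 : ((Q : ℝ) ^ ((i : ℕ) + 1))⁻¹ ≤ 1 :=
    inv_le_one_of_one_le₀ (one_le_pow₀ (by exact_mod_cast hQ))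
  simp only [latticeFreq]
  nlinarith

theorem le_latticeFreq_apply {n M Q : ℕ} {L : ℝ} (hL : 0 ≤ L) (m : Fin n → Fin M)
    (i : Fin n) : L * M ≤ latticeFreq M Q L m i := by
  simp only [latticeFreq]
  have : 0 ≤ ((Q : ℝ) ^ ((i : ℕ) + 1))⁻¹ := by positivity
  have : (0 : ℝ) ≤ ((m i : ℕ) : ℝ) := by positivity
  gcongr
  linarith

theorem EuclideanSpace.norm_le_card_mul {n : ℕ} {x : EuclideanSpace ℝ (Fin n)} {b : ℝ}
    (h : ∀ i, |x i| ≤ b) : ‖x‖ ≤ n * b := by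
  rcases n.eq_zero_or_pos with rfl | hn
  · simp [Subsingleton.elim x 0]
  have hb : 0 ≤ b := (abs_nonneg _).trans (h ⟨0, hn⟩)
  rw [EuclideanSpace.norm_eq]
  apply Real.sqrt_le_iff.2 ⟨by positivity, ?_⟩
  calc ∑ i, ‖x i‖ ^ 2 ≤ ∑ _i : Fin n, b ^ 2 := by
        gcongr with i
        exact h i
    _ = n * b ^ 2 := by simp
    _ ≤ n ^ 2 * b ^ 2 := by
        gcongr
        exact_mod_cast Nat.le_self_pow two_ne_zero n
    _ = (n * b) ^ 2 := by ring

theorem norm_latticeFreq_le {n M Q : ℕ} (hQ : 0 < Q) {L : ℝ} (hL : 0 ≤ L) (m : Fin n → Fin M) :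
    ‖latticeFreq M Q L m‖ ≤ n * (2 * (L * M)) := by
  refine EuclideanSpace.norm_le_card_mul fun i => ?_
  rw [abs_of_nonneg ((by positivity : 0 ≤ L * M).trans (le_latticeFreq_apply hL m i))]
  exact latticeFreq_apply_le hQ hL m i

theorem freqSet_subset_annulus {n M Q : ℕ} (hn : 0 < n) (hM : 0 < M) (hQ : 0 < Q) {L ε : ℝ}
    (hL : 1 ≤ L) (hε : ε ≤ 1 / 2) :
    freqSet n M Q L ε ⊆ annulus n (1 / 2 * (L * M)) (3 * n * (L * M)) := by
  intro ξ hξ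
  obtain ⟨m, hm⟩ := Set.mem_iUnion.1 hξ
  rw [mem_ball_iff_norm] at hm
  have hM' : (1 : ℝ) ≤ M := by exact_mod_cast hM
  have hn' : (1 : ℝ) ≤ n := by exact_mod_cast hn
  have hLM : 1 ≤ L * M := by nlinarith
  have h1 := norm_latticeFreq_le hQ (zero_le_one.trans hL) m
  have h2 : L * M ≤ ‖latticeFreq M Q L m‖ :=
    (le_latticeFreq_apply (zero_le_one.trans hL) m ⟨0, hn⟩).trans
      ((le_abs_self _).trans (PiLp.norm_apply_le (latticeFreq M Q L m) ⟨0, hn⟩))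
  have h3 := norm_sub_norm_le (latticeFreq M Q L m) ξ
  have h4 := norm_sub_norm_le ξ (latticeFreq M Q L m)
  rw [norm_sub_rev] at h3
  constructor
  · linarith
  · nlinarith

/-! ### Phases on the frequency set -/

/-- The offset Q^(-(i+1))/2 enters through the cross term of the square, giving mᵢ j/Q^(i+1). The
remaining terms that depend on m are integers. -/
theorem phase_latticeFreq {n M Q : ℕ} {L : ℝ} (hL : L ≠ 0) (x : EuclideanSpace ℝ (Fin n)) (j : ℕ)
    (m : Fin n → Fin M) :
    inner ℝ x (latticeFreq M Q L m) - j / L ^ 2 * ‖latticeFreq M Q L m‖ ^ 2 =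
      ∑ i : Fin n, (x i * L * (M + ((Q : ℝ) ^ ((i : ℕ) + 1))⁻¹ / 2)
        - j * (M + ((Q : ℝ) ^ ((i : ℕ) + 1))⁻¹ / 2) ^ 2)
      + ∑ i : Fin n, (m i : ℕ) * (L * x i - j / (Q : ℝ) ^ ((i : ℕ) + 1))
      - ∑ i : Fin n, ((2 * j * M * (m i : ℕ) + j * (m i : ℕ) ^ 2 : ℤ) : ℝ) := by
  rw [EuclideanSpace.norm_sq_eq, PiLp.inner_apply, Finset.mul_sum, ← Finset.sum_sub_distrib,
    ← Finset.sum_add_distrib, ← Finset.sum_sub_distrib]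
  refine Finset.sum_congr rfl fun i _ => ?_
  simp only [latticeFreq, Real.norm_eq_abs, sq_abs, RCLike.inner_apply, conj_trivial]
  push_cast
  rw [div_eq_mul_inv _ ((Q : ℝ) ^ ((i : ℕ) + 1))]
  generalize ((Q : ℝ) ^ ((i : ℕ) + 1))⁻¹ = q
  field_simp
  ring

theorem abs_phase_sub_phase_le {n : ℕ} {x p ξ : EuclideanSpace ℝ (Fin n)} {a b ε : ℝ} (ha : 0 ≤ a)
    (hx : ‖x‖ ≤ 1) (hp : ‖p‖ ≤ b) (hξ : ‖ξ - p‖ ≤ ε) :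
    |(inner ℝ x ξ - a * ‖ξ‖ ^ 2) - (inner ℝ x p - a * ‖p‖ ^ 2)| ≤ ε + a * (2 * b + ε) * ε := by
  have e : (inner ℝ x ξ - a * ‖ξ‖ ^ 2) - (inner ℝ x p - a * ‖p‖ ^ 2) =
      inner ℝ x (ξ - p) - a * (‖ξ‖ + ‖p‖) * (‖ξ‖ - ‖p‖) := by
    rw [inner_sub_right]
    ring
  have h1 : |inner ℝ x (ξ - p)| ≤ ε :=
    (abs_real_inner_le_norm _ _).trans
      ((mul_le_of_le_one_left (norm_nonneg _) hx).trans hξ)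
  have h2 : |‖ξ‖ - ‖p‖| ≤ ε := (abs_norm_sub_norm_le _ _).trans hξ
  have h3 : ‖ξ‖ ≤ ‖p‖ + ε := by linarith [(abs_le.1 h2).2]
  rw [e]
  refine (abs_sub _ _).trans (add_le_add h1 ?_)
  rw [abs_mul, abs_of_nonneg (by positivity)]
  exact mul_le_mul (mul_le_mul_of_nonneg_left (by linarith) ha) h2 (abs_nonneg _)
    (mul_nonneg ha (by linarith [norm_nonneg ξ, norm_nonneg p]))

theorem exists_time_phase_near_int {n M Q : ℕ} (hQ : 0 < Q) (hMQ : 20 * n * M ≤ Q) {L ε : ℝ}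
    (hL : 0 < L)
    (hε : ε + 2 * (Q : ℝ) ^ n / L ^ 2 * (2 * (n * (2 * (L * M))) + ε) * ε ≤ 1 / 20) (hε0 : 0 ≤ ε)
    {x : EuclideanSpace ℝ (Fin n)} (hx : ‖x‖ ≤ 1) :
    ∃ j : ℕ, 0 < j ∧ j ≤ 2 * Q ^ n ∧ ∃ c : ℝ, ∀ ξ ∈ freqSet n M Q L ε, ∃ N : ℤ,
      |inner ℝ x ξ - j / L ^ 2 * ‖ξ‖ ^ 2 - c - N| ≤ 1 / 10 := by
  -- The index used is Q^n + j, so that the time is strictly positive; the target is shifted by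
  -- Q^n/Q^(i+1) to compensate.
  obtain ⟨j, hj, h⟩ := exists_nat_lt_pow_forall_abs_sub_le hQ
    (fun i => if hi : i < n then L * x ⟨i, hi⟩ - (Q ^ n : ℕ) / (Q : ℝ) ^ (i + 1) else 0) n
  have hQ' : (0 : ℝ) < Q := by exact_mod_cast hQ
  choose! z hz using h
  refine ⟨Q ^ n + j, by positivity, by omega,
    ∑ i : Fin n, (x i * L * (M + ((Q : ℝ) ^ ((i : ℕ) + 1))⁻¹ / 2)
        - (Q ^ n + j : ℕ) * (M + ((Q : ℝ) ^ ((i : ℕ) + 1))⁻¹ / 2) ^ 2), fun ξ hξ => ?_⟩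
  obtain ⟨m, hm⟩ := Set.mem_iUnion.1 hξ
  rw [mem_ball_iff_norm] at hm
  refine ⟨∑ i : Fin n, ((m i : ℕ) * z i -
    (2 * (Q ^ n + j : ℕ) * M * (m i : ℕ) + (Q ^ n + j : ℕ) * (m i : ℕ) ^ 2)), ?_⟩
  have hj2 : ((Q ^ n + j : ℕ) : ℝ) ≤ 2 * (Q : ℝ) ^ n := by
    have : Q ^ n + j ≤ 2 * Q ^ n := by omega
    exact_mod_cast this
  have h1 := abs_phase_sub_phase_le (a := (Q ^ n + j : ℕ) / L ^ 2) (by positivity) hx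
    (norm_latticeFreq_le hQ hL.le m) hm.le
  have h2 : |∑ i : Fin n, (m i : ℕ) *
      (L * x i - (Q ^ n + j : ℕ) / (Q : ℝ) ^ ((i : ℕ) + 1) - z i)| ≤ 1 / 20 := by
    refine (Finset.abs_sum_le_sum_abs _ _).trans ?_
    calc _ ≤ ∑ i : Fin n, (M : ℝ) * (1 / Q) := by
          refine Finset.sum_le_sum fun i _ => ?_
          rw [abs_mul, Nat.abs_cast]
          have := hz i i.2
          simp only [i.2, dif_pos, Fin.eta] at this
          gcongr
          · exact (m i).2.le
          · convert! this using 2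
            push_cast
            ring
      _ = n * M / Q := by simp [div_eq_mul_inv, mul_assoc]
      _ ≤ 1 / 20 := by
          rw [div_le_div_iff₀ hQ' (by norm_num)]
          have : (20 * n * M : ℝ) ≤ Q := by exact_mod_cast hMQ
          linarith
  have h3 : ε + (Q ^ n + j : ℕ) / L ^ 2 * (2 * (n * (2 * (L * M))) + ε) * ε ≤ 1 / 20 := by
    refine le_trans ?_ hε
    gcongr
  rw [phase_latticeFreq hL.ne'] at h1
  have h4 := abs_add_le _ _ |>.trans (add_le_add (h1.trans h3) h2)
  convert! h4 using 1
  · congr 1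
    push_cast
    simp only [Finset.sum_sub_distrib, mul_sub]
    ring
  · norm_num

/-! ### Data with indicator Fourier transform -/

/-- The function in `L²(ℝⁿ)` whose Fourier transform is the indicator of `A`. -/
noncomputable def invFourierIndicator {n : ℕ} {A : Set (EuclideanSpace ℝ (Fin n))}
    (hA : MeasurableSet A) (hA' : volume A ≠ ∞) : L2 n :=
  𝓕⁻ (indicatorConstLp 2 hA hA' (1 : ℂ) : L2 n)

section invFourierIndicator

variable {n : ℕ} {A : Set (EuclideanSpace ℝ (Fin n))} (hA : MeasurableSet A) (hA' : volume A ≠ ∞)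

theorem fourier_invFourierIndicator :
    (𝓕 (invFourierIndicator hA hA') : L2 n) = indicatorConstLp 2 hA hA' (1 : ℂ) :=
  FourierTransform.fourier_fourierInv_eq _

theorem norm_invFourierIndicator :
    ‖invFourierIndicator hA hA'‖ = √(volume.real A) := by
  rw [← Lp.norm_fourier_eq, fourier_invFourierIndicator,
    norm_indicatorConstLp two_ne_zero ENNReal.ofNat_ne_top, Real.sqrt_eq_rpow]
  simp

theorem fourierSupportedIn_invFourierIndicator {B : Set (EuclideanSpace ℝ (Fin n))} (hAB : A ⊆ B) :
    FourierSupportedIn (invFourierIndicator hA hA') B := by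
  rw [FourierSupportedIn, fourier_invFourierIndicator]
  filter_upwards [indicatorConstLp_coeFn_notMem (p := 2) (hs := hA) (hμs := hA') (c := (1 : ℂ))]
    with ξ hξ h
  exact hξ fun h' => h (hAB h')

theorem schrodinger_invFourierIndicator (t : ℝ) (x : EuclideanSpace ℝ (Fin n)) :
    schrodinger (invFourierIndicator hA hA') t x = ∫ ξ in A, Complex.exp (Complex.I *
      ((2 * Real.pi * (inner ℝ x ξ - 2 * Real.pi * t * ‖ξ‖ ^ 2) : ℝ) : ℂ)) := by
  rw [schrodinger, fourier_invFourierIndicator, ← integral_indicator hA]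
  refine integral_congr_ae ?_
  filter_upwards [indicatorConstLp_coeFn (p := 2) (hs := hA) (hμs := hA') (c := (1 : ℂ))] with ξ hξ
  rw [hξ]
  by_cases h : ξ ∈ A
  · simp only [Set.indicator_of_mem h, one_mul]
    congr 3
    ring
  · simp [Set.indicator_of_notMem h]

theorem ofReal_le_eLpNorm_schrodingerMax_div (hpos : 0 < volume.real A) {T r : ℝ} (hr : 0 < r)
    (h : ∀ x : EuclideanSpace ℝ (Fin n), ‖x‖ ≤ 1 → ∃ t ∈ Set.Ioc 0 T, ∃ c : ℝ, ∀ ξ ∈ A, ∃ N : ℤ,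
      |inner ℝ x ξ - 2 * Real.pi * t * ‖ξ‖ ^ 2 - c - N| ≤ 1 / 10) :
    ENNReal.ofReal (√(volume.real (Metric.ball (0 : EuclideanSpace ℝ (Fin n)) 1)) / 2 *
        √(volume.real A) / r) ≤
      eLpNorm (schrodingerMax T (invFourierIndicator hA hA')) 2
        (volume.restrict (Metric.ball (0 : EuclideanSpace ℝ (Fin n)) 1)) /
        (ENNReal.ofReal r * ‖invFourierIndicator hA hA'‖ₑ) := by
  have hmax : ∀ x : EuclideanSpace ℝ (Fin n), ‖x‖ ≤ 1 →
      ENNReal.ofReal (volume.real A / 2) ≤ schrodingerMax T (invFourierIndicator hA hA') x := by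
    intro x hx
    obtain ⟨t, ht, c, hc⟩ := h x hx
    refine le_trans ?_ (le_iSup₂ (f := fun t _ =>
      ‖schrodinger (invFourierIndicator hA hA') t x‖ₑ) t ht)
    rw [← ofReal_norm, schrodinger_invFourierIndicator]
    exact ENNReal.ofReal_le_ofReal (half_measureReal_le_norm_setIntegral_exp hA hA'
      (by fun_prop) c hc)
  have hlow : ENNReal.ofReal (volume.real A / 2 *
        √(volume.real (Metric.ball (0 : EuclideanSpace ℝ (Fin n)) 1))) ≤
      eLpNorm (schrodingerMax T (invFourierIndicator hA hA')) 2
        (volume.restrict (Metric.ball (0 : EuclideanSpace ℝ (Fin n)) 1)) := by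
    calc _ = eLpNorm (fun _ => ENNReal.ofReal (volume.real A / 2)) 2
          (volume.restrict (Metric.ball (0 : EuclideanSpace ℝ (Fin n)) 1)) := by
          rw [eLpNorm_const' _ two_ne_zero ENNReal.ofNat_ne_top, ENNReal.ofReal_mul (by positivity),
            Real.sqrt_eq_rpow, ← ENNReal.ofReal_rpow_of_nonneg measureReal_nonneg (by norm_num),
            ofReal_measureReal]
          simp
      _ ≤ _ := by
          refine eLpNorm_mono_enorm_ae ?_
          filter_upwards [ae_restrict_mem measurableSet_ball] with x hx
          simpa using hmax x (mem_ball_zero_iff.1 hx).le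
  have hs := Real.sqrt_pos.2 hpos
  rw [← ofReal_norm, norm_invFourierIndicator, ← ENNReal.ofReal_mul hr.le]
  refine le_trans (le_of_eq ?_) (ENNReal.div_le_div_right hlow _)
  rw [← ENNReal.ofReal_div_of_pos (by positivity)]
  congr 1
  have := Real.mul_self_sqrt hpos.le
  field_simp
  linear_combination √(volume.real (Metric.ball (0 : EuclideanSpace ℝ (Fin n)) 1)) * this

end invFourierIndicator

/-! ### Choice of scales -/

/-- The identity Q^n M = (20n)^n L makes time × frequency bounded independently of M, so ε can be
chosen from n alone. -/
theorem error_le_of_scale {n M Q : ℕ} (hM : 0 < M) (hQ : Q = 20 * n * M) {L ε : ℝ}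
    (hL : L = M ^ (n + 1)) (hε : ε = 1 / (20 * (1 + 2 * (20 * n) ^ n * (4 * n + 1)))) :
    ε + 2 * (Q : ℝ) ^ n / L ^ 2 * (2 * (n * (2 * (L * M))) + ε) * ε ≤ 1 / 20 := by
  have hM' : (1 : ℝ) ≤ M := by exact_mod_cast hM
  have hε0 : 0 < ε := by rw [hε]; positivity
  have hK : ε * (1 + 2 * (20 * n) ^ n * (4 * n + 1)) = 1 / 20 := by
    rw [hε]
    field_simp
  have hε1 : ε ≤ 1 := by
    have : 0 ≤ ε * (2 * (20 * n) ^ n * (4 * n + 1)) := by positivity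
    linarith
  have hL1 : 1 ≤ L := hL ▸ one_le_pow₀ hM'
  have hLM : 1 ≤ L * M := by nlinarith
  calc _ ≤ ε + 2 * (Q : ℝ) ^ n / L ^ 2 * (2 * (n * (2 * (L * M))) + L * M) * ε := by
        gcongr
        linarith
    _ = ε * (1 + 2 * (20 * n) ^ n * (4 * n + 1)) := by
        have : (Q : ℝ) ^ n * M = (20 * n) ^ n * L := by
          rw [hQ, hL]
          push_cast
          ring
        have hL0 : L ≠ 0 := by positivity
        field_simp
        linear_combination 2 * (4 * n + 1) * this
    _ ≤ _ := hK.le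

theorem theorem1 (n : ℕ) (hn : 2 ≤ n) :
    ∃ c C : ℝ, 0 < c ∧ c < C ∧
      ∀ s : ℝ, s < (n : ℝ) / (2 * ((n : ℝ) + 2)) →
        ∃ (R : ℕ → ℝ) (f : ℕ → L2 n),
          (∀ k, 0 < R k) ∧ Tendsto R atTop atTop ∧
          (∀ k, f k ≠ 0) ∧
          (∀ k, FourierSupportedIn (f k) (annulus n (c * R k) (C * R k))) ∧
          ∀ T : ℝ, 0 < T →
            Tendsto (fun k =>
              eLpNorm (schrodingerMax T (f k)) 2
                  (volume.restrict (Metric.ball (0 : EuclideanSpace ℝ (Fin n)) 1)) /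
                (ENNReal.ofReal (R k ^ s) * ‖f k‖ₑ))
              atTop (𝓝 ∞) := by
  have hn0 : 0 < n := by omega
  have hn' : (2 : ℝ) ≤ n := by exact_mod_cast hn
  refine ⟨1 / 2, 3 * n, by norm_num, by linarith, fun s hs => ?_⟩
  obtain ⟨ε, hε⟩ : ∃ ε : ℝ, ε = 1 / (20 * (1 + 2 * (20 * n) ^ n * (4 * n + 1))) := ⟨_, rfl⟩
  have hε0 : 0 < ε := by rw [hε]; positivity
  have hε2 : ε ≤ 1 / 2 := by
    rw [hε]
    refine one_div_le_one_div_of_le (by norm_num) ?_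
    have : (0 : ℝ) ≤ 2 * (20 * n) ^ n * (4 * n + 1) := by positivity
    linarith
  let M : ℕ → ℕ := fun k => k + 1
  let Q : ℕ → ℕ := fun k => 20 * n * M k
  let L : ℕ → ℝ := fun k => (M k : ℝ) ^ (n + 1)
  have hM : ∀ k, 0 < M k := fun k => k.succ_pos
  have hM1 : ∀ k, (1 : ℝ) ≤ M k := fun k => by exact_mod_cast hM k
  have hM0 : ∀ k, (0 : ℝ) < M k := fun k => by linarith [hM1 k]
  have hQ : ∀ k, 0 < Q k := fun k => by have := hM k; positivity
  have hL : ∀ k, 1 ≤ L k := fun k => one_le_pow₀ (hM1 k)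
  have hL0 : ∀ k, 0 < L k := fun k => by linarith [hL k]
  have hMt : Tendsto (fun k => (M k : ℝ)) atTop atTop :=
    tendsto_natCast_atTop_atTop.comp (tendsto_add_atTop_nat 1)
  let A : ℕ → Set (EuclideanSpace ℝ (Fin n)) := fun k => freqSet n (M k) (Q k) (L k) ε
  have hA : ∀ k, MeasurableSet (A k) := fun k => (isOpen_freqSet _ _ _ _ _).measurableSet
  have hA' : ∀ k, volume (A k) ≠ ∞ := fun k => volume_freqSet_ne_top _ _ _ _ _
  obtain ⟨v, hv⟩ : ∃ v, v = volume.real (Metric.ball (0 : EuclideanSpace ℝ (Fin n)) ε) := ⟨_, rfl⟩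
  have hball : ∀ r : ℝ, 0 < r →
      0 < volume.real (Metric.ball (0 : EuclideanSpace ℝ (Fin n)) r) := fun r hr =>
    ENNReal.toReal_pos (Metric.measure_ball_pos _ _ hr).ne' measure_ball_lt_top.ne
  have hv0 : 0 < v := hv ▸ hball ε hε0
  have hAv : ∀ k, (M k : ℝ) ^ n * v ≤ volume.real (A k) := fun k =>
    hv ▸ pow_mul_le_volume_freqSet hε0 (by linarith [hL k])
  have hApos : ∀ k, 0 < volume.real (A k) := fun k =>
    lt_of_lt_of_le (by have := hM0 k; positivity) (hAv k)
  refine ⟨fun k => L k * M k, fun k => invFourierIndicator (hA k) (hA' k),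
    fun k => mul_pos (hL0 k) (hM0 k), ?_, fun k => ?_, fun k => ?_, fun T hT => ?_⟩
  · exact tendsto_atTop_mono (fun k => le_mul_of_one_le_left (hM0 k).le (hL k)) hMt
  · rw [← norm_pos_iff, norm_invFourierIndicator]
    exact Real.sqrt_pos.2 (hApos k)
  · exact fourierSupportedIn_invFourierIndicator _ _
      (freqSet_subset_annulus hn0 (hM k) (hQ k) (hL k) hε2)
  · obtain ⟨b, hb⟩ : ∃ b, b = √(volume.real (Metric.ball (0 : EuclideanSpace ℝ (Fin n)) 1)) :=
      ⟨_, rfl⟩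
    have hb0 : 0 < b := hb ▸ Real.sqrt_pos.2 (hball 1 one_pos)
    have hexp : 0 < (n : ℝ) / 2 - (n + 2) * s := by
      rw [lt_div_iff₀ (by positivity)] at hs
      linarith
    have hlim : Tendsto (fun k => ENNReal.ofReal
        (b / 2 * √v * (M k : ℝ) ^ ((n : ℝ) / 2 - (n + 2) * s))) atTop (𝓝 ∞) := by
      refine ENNReal.tendsto_ofReal_atTop.comp (Tendsto.const_mul_atTop (by positivity) ?_)
      exact (tendsto_rpow_atTop hexp).comp hMt
    refine tendsto_nhds_top_mono hlim ?_
    -- The times used are at most Q^n/(πL²), which is below T once M ≥ (20n)^n/T.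
    filter_upwards [hMt.eventually_ge_atTop ((20 * n) ^ n / T)] with k hk
    have hrpow : (L k * M k) ^ s = (M k : ℝ) ^ ((n + 2) * s) := by
      rw [Real.rpow_mul (hM0 k).le]
      congr 1
      rw [← pow_succ]
      exact_mod_cast (Real.rpow_natCast (M k : ℝ) (n + 2)).symm
    refine le_trans (ENNReal.ofReal_le_ofReal ?_) (ofReal_le_eLpNorm_schrodingerMax_div (hA k)
      (hA' k) (hApos k) (Real.rpow_pos_of_pos (mul_pos (hL0 k) (hM0 k)) s) fun x hx => ?_)
    · rw [← hb, hrpow, Real.rpow_sub (hM0 k), ← mul_div_assoc]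
      have h1 : √v * (M k : ℝ) ^ ((n : ℝ) / 2) ≤ √(volume.real (A k)) := by
        refine le_trans (le_of_eq ?_) (Real.sqrt_le_sqrt (hAv k))
        rw [mul_comm ((M k : ℝ) ^ n), Real.sqrt_mul hv0.le, Real.sqrt_eq_rpow ((M k : ℝ) ^ n),
          ← Real.rpow_natCast_mul (hM0 k).le]
        ring_nf
      rw [mul_assoc (b / 2)]
      have := hM0 k
      gcongr
    · obtain ⟨j, hj0, hj, c, hc⟩ := exists_time_phase_near_int (hQ k) le_rfl (hL0 k)
        (error_le_of_scale (hM k) rfl rfl hε) hε0.le hx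
      have hLk := hL0 k
      have hpi := Real.pi_gt_three
      refine ⟨j / (2 * Real.pi * L k ^ 2), ⟨by positivity, ?_⟩, c, fun ξ hξ => ?_⟩
      · have hj' : (j : ℝ) ≤ 2 * ((20 * n) ^ n * (M k : ℝ) ^ n) := by
          rw [← mul_pow]
          exact_mod_cast hj
        rw [div_le_iff₀ hT] at hk
        rw [div_le_iff₀ (by positivity)]
        have h2 : (M k : ℝ) * (M k : ℝ) ^ n ≤ L k ^ 2 := by
          rw [← pow_succ']
          exact le_self_pow₀ (hL k) two_ne_zero
        calc (j : ℝ) ≤ 2 * ((20 * n) ^ n * (M k : ℝ) ^ n) := hj'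
          _ ≤ 2 * (M k * T * (M k : ℝ) ^ n) := by gcongr
          _ = T * (2 * 1 * (M k * (M k : ℝ) ^ n)) := by ring
          _ ≤ T * (2 * Real.pi * L k ^ 2) := by
              gcongr
              linarith
      · obtain ⟨N, hN⟩ := hc ξ hξ
        refine ⟨N, ?_⟩
        convert! hN using 5
        field_simp
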